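/- Let $\mathbf B_3=\langle\sigma_1,\sigma_2\mid\sigma_1\sigma_2\sigma_1=\sigma_2\sigma_1\sigma_2\rangle$ and $\Delta=\sigma_1\sigma_2\sigma_1$. A quasipositive factorization of $X\in\mathbf B_3$ is a tuple $(X_1,\dots,X_k)\in\mathbf B_3^k$, $k\ge 0$, with $X_1\cdots X_k=X$ in which every $X_i$ is conjugate in $\mathbf B_3$ to $\sigma_1$; $X$ is quasipositive if it has one. The Hurwitz action of the braid group $\mathbf B_k$ on $\mathbf B_3^k$ is the action in which the $i$-th standard generator ($1\le i<k$) replaces $(X_i,X_{i+1})$ by $(X_iX_{i+1}X_i^{-1},X_i)$ and keeps the other entries; it preserves the set of quasipositive factorizations of a given $X$. A positive word is a word $W\equiv a_1\dots a_n$ ($n\ge 0$) in the letters $\sigma_1,\sigma_2$. For $I=\{i_1<\dots<i_k\}\subseteq\{1,\dots,n\}$, let $W\setminus I$ be the word obtained from $W$ by deleting the letters at the positions in $I$, and put $$W_I=(A_1x_1A_1^{-1},\dots,A_kx_kA_k^{-1}),\qquad x_j=a_{i_j},$$ where $A_j$ is the word formed by the letters $a_l$ with $l<i_j$, $l\notin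 I$, in their order. The set $I$ is called $W$-minimal if there is no $i\in I$ with $i\ge 2$, $i-1\notin I$ and $a_{i-1}=a_i$ (the same letter). **Theorem 1.** Let $W$ be a positive word and $p\ge 0$ an integer, and suppose that the braid $X=W\Delta^{-p}$ is quasipositive. Then every orbit of the Hurwitz action on quasipositive factorizations of $X$ contains an element of the form $W_I$ with $W$-minimal $I$. In particular, for this $I$, the word $W\setminus I$ is equal to $\Delta^p$ in $\mathbf B_3$. -/

import Mathlib

open FreeGroup in
/-- The braid relations among `n - 1` generators (indexed from `0`):
`σᵢ σᵢ₊₁ σᵢ = σᵢ₊₁ σᵢ σᵢ₊₁`, and `σᵢ σⱼ = σⱼ σᵢ` for `j ≥ i + 2`. -/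
def braidRelators (n : ℕ) : Set (FreeGroup (Fin (n - 1))) :=
  {r | ∃ i j : Fin (n - 1), j.val = i.val + 1 ∧
      r = of i * of j * of i * (of j * of i * of j)⁻¹} ∪
  {r | ∃ i j : Fin (n - 1), i.val + 2 ≤ j.val ∧ r = of i * of j * (of j * of i)⁻¹}

/-- The braid group `B_n` on `n` strings, through Artin's presentation. -/
abbrev BraidGroup (n : ℕ) : Type := PresentedGroup (braidRelators n)

/-- The standard Artin generators of `B_n`, indexed from `0`. -/
def BraidGroup.gen {n : ℕ} (i : Fin (n - 1)) : BraidGroup n := PresentedGroup.of i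

section Hurwitz

/-- The first of the two positions on which the `i`-th Hurwitz move acts. -/
def hurwitzFst {k : ℕ} (i : Fin (k - 1)) : Fin k := ⟨i.val, by omega⟩

/-- The second of the two positions on which the `i`-th Hurwitz move acts. -/
def hurwitzSnd {k : ℕ} (i : Fin (k - 1)) : Fin k := ⟨i.val + 1, by omega⟩

/-- The Hurwitz move `Σᵢ`: the entries `Xᵢ, Xᵢ₊₁` of a tuple are replaced by
`Xᵢ Xᵢ₊₁ Xᵢ⁻¹, Xᵢ`, the other entries are kept.  It is a bijection of `G^k`. -/
def hurwitzMove {G : Type*} [Group G] {k : ℕ} (i : Fin (k - 1)) :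
    Equiv.Perm (Fin k → G) where
  toFun X j :=
    if j = hurwitzFst i then
      X (hurwitzFst i) * X (hurwitzSnd i) * (X (hurwitzFst i))⁻¹
    else if j = hurwitzSnd i then X (hurwitzFst i)
    else X j
  invFun Y j :=
    if j = hurwitzFst i then Y (hurwitzSnd i)
    else if j = hurwitzSnd i then
      (Y (hurwitzSnd i))⁻¹ * Y (hurwitzFst i) * Y (hurwitzSnd i)
    else Y j
  left_inv X := by
    have h : hurwitzSnd i ≠ hurwitzFst i := by simp [hurwitzFst, hurwitzSnd]
    funext j
    by_cases h1 : j = hurwitzFst i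
    · subst h1; simp [h]
    · by_cases h2 : j = hurwitzSnd i
      · subst h2; simp [h, mul_assoc]
      · simp [h1, h2]
  right_inv Y := by
    have h : hurwitzSnd i ≠ hurwitzFst i := by simp [hurwitzFst, hurwitzSnd]
    funext j
    by_cases h1 : j = hurwitzFst i
    · subst h1; simp [h, mul_assoc]
    · by_cases h2 : j = hurwitzSnd i
      · subst h2; simp [h]
      · simp [h1, h2]

theorem hurwitzMove_braid {G : Type*} [Group G] {k : ℕ} (i j : Fin (k - 1))
    (h : j.val = i.val + 1) :
    (hurwitzMove i * hurwitzMove j * hurwitzMove i : Equiv.Perm (Fin k → G)) =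
      hurwitzMove j * hurwitzMove i * hurwitzMove j := by
  ext X l
  simp only [Equiv.Perm.mul_apply, hurwitzMove, Equiv.coe_fn_mk, hurwitzFst, hurwitzSnd,
    Fin.ext_iff, h]
  split_ifs <;> first | omega | simp [mul_assoc]

theorem hurwitzMove_comm {G : Type*} [Group G] {k : ℕ} (i j : Fin (k - 1))
    (h : i.val + 2 ≤ j.val) :
    (hurwitzMove i * hurwitzMove j : Equiv.Perm (Fin k → G)) =
      hurwitzMove j * hurwitzMove i := by
  ext X l
  simp only [Equiv.Perm.mul_apply, hurwitzMove, Equiv.coe_fn_mk, hurwitzFst, hurwitzSnd,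
    Fin.ext_iff]
  split_ifs <;> first | omega | simp [mul_assoc]

/-- The Hurwitz action of the braid group `B_k` on `G^k`, in which `σᵢ` acts as `Σᵢ`. -/
def hurwitzAction (G : Type*) [Group G] (k : ℕ) :
    BraidGroup k →* Equiv.Perm (Fin k → G) :=
  PresentedGroup.toGroup (f := hurwitzMove) (by
    rintro r (⟨i, j, h, rfl⟩ | ⟨i, j, h, rfl⟩)
    · rw [map_mul, map_inv, mul_inv_eq_one]
      simpa using hurwitzMove_braid i j h
    · rw [map_mul, map_inv, mul_inv_eq_one]
      simpa using hurwitzMove_comm i j h)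

/-- The orbit of a tuple under the Hurwitz action. -/
def hurwitzOrbit {G : Type*} [Group G] {k : ℕ} (X : Fin k → G) : Set (Fin k → G) :=
  Set.range fun β : BraidGroup k => hurwitzAction G k β X

end Hurwitz

namespace ThreeBraid

/-- The standard generators of `B_3`: `σ 0` is `σ₁` and `σ 1` is `σ₂`. -/
def σ (a : Fin 2) : BraidGroup 3 := BraidGroup.gen (n := 3) a

/-- The Garside element `Δ = σ₁ σ₂ σ₁`. -/
def Δ : BraidGroup 3 := σ 0 * σ 1 * σ 0

/-- `(X₁, …, X_k)` is a quasipositive factorization of `X`: the product `X₁ ⋯ X_k` is `X` and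
every `Xᵢ` is conjugate to `σ₁`. -/
def IsQuasipositiveFactorization (X : BraidGroup 3) {k : ℕ} (F : Fin k → BraidGroup 3) : Prop :=
  (List.ofFn F).prod = X ∧ ∀ i, IsConj (σ 0) (F i)

/-- A 3-braid is quasipositive if it has a quasipositive factorization. -/
def IsQuasipositive (X : BraidGroup 3) : Prop :=
  ∃ (k : ℕ) (F : Fin k → BraidGroup 3), IsQuasipositiveFactorization X F

/-- A positive word is a word in the letters `σ₁` (written `0`) and `σ₂` (written `1`). -/
abbrev PositiveWord : Type := List (Fin 2)

namespace PositiveWord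

/-- The braid represented by a positive word. -/
def toBraid (W : PositiveWord) : BraidGroup 3 := (W.map σ).prod

/-- The word `W ∖ I`: the letters of `W` at the positions in `I` are deleted. -/
def remove (W : PositiveWord) (I : Finset (Fin W.length)) : PositiveWord :=
  ((List.finRange W.length).filter fun l => l ∉ I).map W.get

/-- The letters of `W` that stand before the position `i` and whose position is not in `I`.  For
the `j`-th element `i` of `I` this is the word `A_j = W₁ ⋯ W_j`, where `W₁, …, W_{k+1}` are the
pieces into which the letters at the positions in `I` split `W`. -/
def removeBefore (W : PositiveWord) (I : Finset (Fin W.length)) (i : Fin W.length) :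
    PositiveWord :=
  ((List.finRange W.length).filter fun l => l < i ∧ l ∉ I).map W.get

/-- The tuple `W_I = (A₁ x₁ A₁⁻¹, …, A_k x_k A_k⁻¹)`, where `I = {i₁ < ⋯ < i_k}` and `x_j` is the
letter of `W` at the position `i_j`. -/
def factorization (W : PositiveWord) (I : Finset (Fin W.length)) {k : ℕ} (hI : I.card = k) :
    Fin k → BraidGroup 3 := fun j =>
  (W.removeBefore I (I.orderEmbOfFin hI j)).toBraid * σ (W.get (I.orderEmbOfFin hI j)) *
    ((W.removeBefore I (I.orderEmbOfFin hI j)).toBraid)⁻¹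

/-- `I` is `W`-minimal: there are no two consecutive positions `i, j = i + 1` carrying the same
letter such that `i ∉ I` and `j ∈ I`. -/
def IsMinimal (W : PositiveWord) (I : Finset (Fin W.length)) : Prop :=
  ¬ ∃ i j : Fin W.length, j.val = i.val + 1 ∧ i ∉ I ∧ j ∈ I ∧ W.get i = W.get j

end PositiveWord

end ThreeBraid

/-!
A tuple is treated as a list up to Hurwitz equivalence, and a pair `(W, I)` as a word some of whose
letters are marked.  Say that `W` *sweeps* a factorization `m` if `m` is Hurwitz equivalent to a
tuple that begins with `U x U⁻¹`, where `x` is a letter of `W` and `U` consists of all letters before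
it.  Deleting `x` from `W` and splitting off `U x U⁻¹` leaves a factorization with one factor less
(`Sweeps.represents`), and a mark put back on `x` extends a marking found for the shorter word
(`extracted_move_front`).  By induction on the number `k` of factors it is therefore enough to show
that `W` sweeps every factorization `m` of `W Δ^{-p}` with `k ≥ 1`.

For `k = 1` this is geometry of the Farey tree (`exists_conj_prefix_eq`).  A conjugate `Y` of `σ₁`
fixes a cusp; measure the height of the edges of the tree over that cusp.  The prefixes of `W` move
the base edge, each letter rotating the current edge about one of its ends, and such a rotation can
raise the height only if it sweeps over the cusp.  As `W = Y Δ^p` raises the height in total, some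
letter does sweep over the cusp, and this letter, conjugated by the letters before it, is `Y`.  The
passage from cusps to braids uses that the stabilizer of `∞` in `B₃` centralizes `σ₁`, a ping-pong
argument (`commute_σ_zero_of_toSL_eq_zero`).

For `k ≥ 2`, writing the conjugating elements as positive words gives one marked word from which `m`
is extracted (`exists_markedWord`).  It is turned into `W` by braid relations and removal of final
factors `Δ`, because words that are equal in `B₃` become equal in the positive monoid after
multiplication by a power of `Δ²` (`exists_braidEquiv_of_toBraid_eq`).  In either kind of step a
marked letter outside of the affected block `x y x` is a letter of the new word, too, and shows
that the new word sweeps `m`.  Otherwise the block contains at least two marks and nothing else is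
marked.  Then, for a braid relation, the first letter of the new block `y x y` can be moved to the
front of `m` (`exists_block_cons`); and if `Δ` is removed, both conjugates that a first letter of the
remaining word can produce can be moved to the front (`exists_conj_block_cons`).

Minimality is reached in the end by pushing marks to the left past equal letters, which does not
change the extracted tuple (`exists_isMinimal`).
-/

/-! ### Hurwitz equivalence of lists -/

section HurwitzLists

variable {G : Type*} [Group G]

/-- One Hurwitz move on a list: neighbours `x, y` are replaced by `x y x⁻¹, x`. -/
inductive HurwitzStep : List G → List G → Prop
  | mk (l : List G) (x y : G) (r : List G) :
      HurwitzStep (l ++ x :: y :: r) (l ++ (x * y * x⁻¹) :: x :: r)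

/-- Hurwitz equivalence of lists: the equivalence relation generated by the Hurwitz moves.  It is
the list form of lying in the same orbit, see `HurwitzEquiv.mem_orbit`. -/
def HurwitzEquiv : List G → List G → Prop := Relation.EqvGen HurwitzStep

namespace HurwitzEquiv

@[refl] theorem refl (l : List G) : HurwitzEquiv l l := Relation.EqvGen.refl l

theorem symm {l m : List G} (h : HurwitzEquiv l m) : HurwitzEquiv m l := Relation.EqvGen.symm _ _ h

theorem trans {l m n : List G} (h : HurwitzEquiv l m) (h' : HurwitzEquiv m n) :
    HurwitzEquiv l n := Relation.EqvGen.trans _ _ _ h h'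

theorem swap (x y : G) (r : List G) : HurwitzEquiv (x :: y :: r) ((x * y * x⁻¹) :: x :: r) :=
  Relation.EqvGen.rel _ _ (HurwitzStep.mk [] x y r)

theorem swap_inv (x y : G) (r : List G) : HurwitzEquiv (x :: y :: r) (y :: (y⁻¹ * x * y) :: r) := by
  have h := (swap y (y⁻¹ * x * y) r).symm
  simpa [mul_assoc] using h

theorem cons (z : G) {l m : List G} (h : HurwitzEquiv l m) : HurwitzEquiv (z :: l) (z :: m) := by
  induction h with
  | rel _ _ h =>
    obtain ⟨l, x, y, r⟩ := h
    exact Relation.EqvGen.rel _ _ (HurwitzStep.mk (z :: l) x y r)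
  | refl => exact refl _
  | symm _ _ _ ih => exact ih.symm
  | trans _ _ _ _ _ ih ih' => exact ih.trans ih'

theorem map (f : G →* G) {l m : List G} (h : HurwitzEquiv l m) :
    HurwitzEquiv (l.map f) (m.map f) := by
  induction h with
  | rel _ _ h =>
    obtain ⟨l, x, y, r⟩ := h
    refine Relation.EqvGen.rel _ _ ?_
    simpa using HurwitzStep.mk (l.map f) (f x) (f y) (r.map f)
  | refl => exact refl _
  | symm _ _ _ ih => exact ih.symm
  | trans _ _ _ _ _ ih ih' => exact ih.trans ih'

theorem prod_eq {l m : List G} (h : HurwitzEquiv l m) : l.prod = m.prod := by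
  induction h with
  | rel _ _ h => obtain ⟨l, x, y, r⟩ := h; simp [mul_assoc]
  | refl => rfl
  | symm _ _ _ ih => exact ih.symm
  | trans _ _ _ _ _ ih ih' => exact ih.trans ih'

theorem length_eq {l m : List G} (h : HurwitzEquiv l m) : l.length = m.length := by
  induction h with
  | rel _ _ h => obtain ⟨l, x, y, r⟩ := h; simp
  | refl => rfl
  | symm _ _ _ ih => exact ih.symm
  | trans _ _ _ _ _ ih ih' => exact ih.trans ih'

theorem forall_isConj {g : G} {l m : List G} (h : HurwitzEquiv l m) :
    (∀ x ∈ l, IsConj g x) ↔ ∀ x ∈ m, IsConj g x := by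
  induction h with
  | rel _ _ h =>
    obtain ⟨l, x, y, r⟩ := h
    have key : IsConj g (x * y * x⁻¹) ↔ IsConj g y :=
      ⟨fun h => h.trans (isConj_iff.2 ⟨x⁻¹, by group⟩), fun h => h.trans (isConj_iff.2 ⟨x, rfl⟩)⟩
    simp only [List.mem_append, List.mem_cons, or_imp, forall_and, forall_eq, key]
    tauto
  | refl => rfl
  | symm _ _ _ ih => exact ih.symm
  | trans _ _ _ _ _ ih ih' => exact ih.trans ih'

/-- Any entry can be moved to the front, at the price of a conjugation by everything that it
passes. -/
theorem move_front (l : List G) (x : G) (r : List G) :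
    HurwitzEquiv (l ++ x :: r) ((l.prod * x * l.prod⁻¹) :: (l ++ r)) := by
  induction l with
  | nil => simpa using refl (x :: r)
  | cons y l ih =>
    have h := (ih.cons y).trans (swap _ _ _)
    simpa [mul_assoc] using h

end HurwitzEquiv

theorem mem_hurwitzOrbit_self {k : ℕ} (F : Fin k → G) : F ∈ hurwitzOrbit F := ⟨1, by simp⟩

theorem mem_hurwitzOrbit_symm {k : ℕ} {F F' : Fin k → G} (h : F' ∈ hurwitzOrbit F) :
    F ∈ hurwitzOrbit F' := by
  obtain ⟨β, rfl⟩ := h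
  exact ⟨β⁻¹, by simp⟩

theorem mem_hurwitzOrbit_trans {k : ℕ} {F F' F'' : Fin k → G} (h : F' ∈ hurwitzOrbit F)
    (h' : F'' ∈ hurwitzOrbit F') : F'' ∈ hurwitzOrbit F := by
  obtain ⟨β, rfl⟩ := h
  obtain ⟨γ, rfl⟩ := h'
  exact ⟨γ * β, by simp⟩

theorem hurwitzMove_mem_hurwitzOrbit {k : ℕ} (i : Fin (k - 1)) (F : Fin k → G) :
    hurwitzMove i F ∈ hurwitzOrbit F :=
  ⟨BraidGroup.gen i, by simp [hurwitzAction, BraidGroup.gen]⟩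

theorem HurwitzStep.mem_orbit {k : ℕ} {F F' : Fin k → G}
    (h : HurwitzStep (List.ofFn F) (List.ofFn F')) : F' ∈ hurwitzOrbit F := by
  generalize hL : List.ofFn F = L, hL' : List.ofFn F' = L' at h
  obtain ⟨l, x, y, r⟩ := h
  have hk : k = l.length + (r.length + 2) := by
    simpa [add_assoc] using congrArg List.length hL
  have hF : ∀ j : Fin k, F j = (l ++ x :: y :: r)[j.val]'(by simp; omega) := fun j => by
    simp [← hL]
  have hF' : ∀ j : Fin k, F' j = (l ++ (x * y * x⁻¹) :: x :: r)[j.val]'(by simp; omega) :=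
    fun j => by simp [← hL']
  have : F' = hurwitzMove ⟨l.length, by omega⟩ F := by
    funext j
    simp only [hurwitzMove, Equiv.coe_fn_mk, hurwitzFst, hurwitzSnd, Fin.ext_iff, hF, hF']
    rcases lt_trichotomy j.val l.length with h | h | h
    · rw [if_neg h.ne, if_neg (by omega), List.getElem_append_left h, List.getElem_append_left h]
    · simp [h]
    · rw [if_neg h.ne']
      obtain ⟨d, hd⟩ := Nat.exists_eq_add_of_lt h
      rcases d with _ | d
      · simp [hd]
      · rw [if_neg (by omega), List.getElem_append_right (by omega),
          List.getElem_append_right (by omega)]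
        simp [hd, add_assoc]
  rw [this]
  exact hurwitzMove_mem_hurwitzOrbit _ _

theorem HurwitzEquiv.mem_orbit {k : ℕ} {F F' : Fin k → G}
    (h : HurwitzEquiv (List.ofFn F) (List.ofFn F')) : F' ∈ hurwitzOrbit F := by
  generalize hL : List.ofFn F = L, hL' : List.ofFn F' = L' at h
  induction h generalizing F F' with
  | rel _ _ h => subst hL hL'; exact h.mem_orbit
  | refl => rw [List.ofFn_injective (hL'.trans hL.symm)]; exact mem_hurwitzOrbit_self F
  | symm _ _ _ ih => exact mem_hurwitzOrbit_symm (ih hL' hL)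
  | trans _ m _ h _ ih ih' =>
    have hk : m.length = k := by rw [← HurwitzEquiv.length_eq h, ← hL, List.length_ofFn]
    subst hk
    exact mem_hurwitzOrbit_trans (ih hL (List.ofFn_get m)) (ih' (List.ofFn_get m) hL')

end HurwitzLists

namespace ThreeBraid

namespace PositiveWord

@[simp] theorem toBraid_nil : toBraid [] = 1 := rfl

@[simp] theorem toBraid_cons (x : Fin 2) (W : PositiveWord) :
    toBraid (x :: W) = σ x * toBraid W := by simp [toBraid]

@[simp] theorem toBraid_append (V W : PositiveWord) :
    toBraid (V ++ W) = toBraid V * toBraid W := by simp [toBraid]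

end PositiveWord

open PositiveWord

/-! ### Marked words -/

/-- A positive word with a set `I` of its letters marked: the flag of a letter says whether its
position belongs to `I`. -/
abbrev MarkedWord : Type := List (Fin 2 × Bool)

namespace MarkedWord

/-- The underlying positive word. -/
def letters (w : MarkedWord) : PositiveWord := w.map Prod.fst

/-- The word `W ∖ I` of the unmarked letters. -/
def kept (w : MarkedWord) : PositiveWord := (w.filter fun c => !c.2).map Prod.fst

/-- The tuple `W_I`, as a list: an unmarked letter conjugates everything behind it. -/
def extracted : MarkedWord → List (BraidGroup 3)
  | [] => []
  | (x, true) :: w => σ x :: extracted w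
  | (x, false) :: w => (extracted w).map (MulAut.conj (σ x))

@[simp] theorem letters_nil : letters [] = [] := rfl

@[simp] theorem letters_cons (c : Fin 2 × Bool) (w : MarkedWord) :
    letters (c :: w) = c.1 :: letters w := rfl

@[simp] theorem letters_append (u v : MarkedWord) : letters (u ++ v) = letters u ++ letters v := by
  simp [letters]

@[simp] theorem kept_nil : kept [] = [] := rfl

@[simp] theorem kept_cons_true (x : Fin 2) (w : MarkedWord) : kept ((x, true) :: w) = kept w := rfl

@[simp] theorem kept_cons_false (x : Fin 2) (w : MarkedWord) :
    kept ((x, false) :: w) = x :: kept w := rfl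

@[simp] theorem kept_append (u v : MarkedWord) : kept (u ++ v) = kept u ++ kept v := by
  simp [kept]

@[simp] theorem extracted_nil : extracted [] = [] := rfl

@[simp] theorem extracted_cons_true (x : Fin 2) (w : MarkedWord) :
    extracted ((x, true) :: w) = σ x :: extracted w := rfl

@[simp] theorem extracted_cons_false (x : Fin 2) (w : MarkedWord) :
    extracted ((x, false) :: w) = (extracted w).map (MulAut.conj (σ x)) := rfl

theorem extracted_append (u v : MarkedWord) :
    extracted (u ++ v) = extracted u ++ (extracted v).map (MulAut.conj (kept u).toBraid) := by
  induction u with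
  | nil => simp
  | cons c u ih => obtain ⟨x, _ | _⟩ := c <;> simp [ih]

theorem prod_extracted (w : MarkedWord) :
    (extracted w).prod * (kept w).toBraid = (letters w).toBraid := by
  induction w with
  | nil => simp
  | cons c w ih =>
    obtain ⟨x, _ | _⟩ := c
    · have h : ((extracted w).map (MulAut.conj (σ x))).prod = MulAut.conj (σ x) (extracted w).prod :=
        (map_list_prod _ _).symm
      simp [h, ← ih, mul_assoc]
    · simp [← ih, mul_assoc]

theorem extracted_eq_nil {w : MarkedWord} (h : ∀ c ∈ w, c.2 = false) : extracted w = [] := by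
  induction w with
  | nil => rfl
  | cons c w ih =>
    obtain ⟨x, b⟩ := c
    obtain rfl : b = false := h (x, b) (by simp)
    simp [ih fun c hc => h c (by simp [hc])]

theorem kept_eq_letters {w : MarkedWord} (h : ∀ c ∈ w, c.2 = false) : kept w = letters w := by
  rw [kept, List.filter_eq_self.2 (by simpa using h), letters]

/-- A marked letter can be brought to the front of the tuple; it then appears conjugated by all
letters before it, marked or not. -/
theorem extracted_move_front (u : MarkedWord) (x : Fin 2) (v : MarkedWord) :
    HurwitzEquiv (extracted (u ++ (x, true) :: v))
      (MulAut.conj (letters u).toBraid (σ x) :: extracted (u ++ v)) := by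
  have h := HurwitzEquiv.move_front (extracted u) (MulAut.conj (kept u).toBraid (σ x))
    ((extracted v).map (MulAut.conj (kept u).toBraid))
  simpa [extracted_append, ← prod_extracted u, mul_assoc] using h

/-- `w` is minimal: no marked letter follows an equal unmarked one. -/
def IsMinimal (w : MarkedWord) : Prop :=
  ∀ u x v, w ≠ u ++ (x, false) :: (x, true) :: v

/-- The number of pairs formed by an unmarked letter and a later marked one. -/
def inversions : MarkedWord → ℕ
  | [] => 0
  | (_, true) :: w => inversions w
  | (_, false) :: w => inversions w + w.countP Prod.snd

theorem inversions_swap (u : MarkedWord) (x y : Fin 2) (v : MarkedWord) :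
    inversions (u ++ (x, true) :: (y, false) :: v) <
      inversions (u ++ (y, false) :: (x, true) :: v) := by
  induction u with
  | nil => simp [inversions]
  | cons c u ih => obtain ⟨z, _ | _⟩ := c <;> simp [inversions] <;> omega

/-- Marks can be pushed to the left past equal unmarked letters without changing the extracted
tuple. -/
theorem exists_isMinimal (w : MarkedWord) :
    ∃ w' : MarkedWord, letters w' = letters w ∧ extracted w' = extracted w ∧ IsMinimal w' := by
  induction hn : inversions w using Nat.strong_induction_on generalizing w with
  | _ n ih =>
    by_cases hw : IsMinimal w
    · exact ⟨w, rfl, rfl, hw⟩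
    · simp only [IsMinimal, not_forall, not_not] at hw
      obtain ⟨u, x, v, rfl⟩ := hw
      obtain ⟨w', h1, h2, h3⟩ := ih _ (hn ▸ inversions_swap u x x v) _ rfl
      refine ⟨w', by simp [h1], ?_, h3⟩
      rw [h2]
      simp [extracted_append]

end MarkedWord

/-! ### Marked words and sets of positions -/

namespace PositiveWord

/-- The word `W` with the positions in `I` marked. -/
def mark (W : PositiveWord) (I : Finset (Fin W.length)) : MarkedWord :=
  (List.finRange W.length).map fun i => (W.get i, decide (i ∈ I))

theorem kept_mark (W : PositiveWord) (I : Finset (Fin W.length)) :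
    (W.mark I).kept = W.remove I := by
  simp [mark, MarkedWord.kept, remove, List.filter_map, Function.comp_def]

theorem exists_mark_eq {W : PositiveWord} {w : MarkedWord} (h : w.letters = W) :
    ∃ I, W.mark I = w := by
  subst h
  have hl : w.letters.length = w.length := by simp [MarkedWord.letters]
  refine ⟨Finset.univ.filter fun i => (w[i.val]'(by omega)).2, ?_⟩
  apply List.ext_getElem
  · simp [mark, hl]
  · intro i h1 h2
    have h3 : (List.finRange w.letters.length)[i]'(by simpa [hl] using h2) =
        ⟨i, hl ▸ h2⟩ := by simp
    simp only [mark, List.getElem_map, h3, Finset.mem_filter, Finset.mem_univ, true_and]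
    simp [MarkedWord.letters]

/-- The extracted tuple for any increasing list `L` of positions in place of all positions. -/
theorem extracted_map_of_sorted (W : PositiveWord) (I : Finset (Fin W.length))
    (L : List (Fin W.length)) (hL : L.Pairwise (· < ·)) :
    MarkedWord.extracted (L.map fun i => (W.get i, decide (i ∈ I))) =
      (L.filter fun i => i ∈ I).map fun i =>
        MulAut.conj (toBraid ((L.filter fun l => l < i ∧ l ∉ I).map W.get)) (σ (W.get i)) := by
  induction L with
  | nil => rfl
  | cons i L ih =>
    rw [List.pairwise_cons] at hL
    have hi : ∀ j ∈ L, i < j := hL.1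
    have hnil : L.filter (fun l => decide (l < i ∧ l ∉ I)) = [] := by
      rw [List.filter_eq_nil_iff]
      intro l hl
      simp [(hi l hl).le]
    by_cases h : i ∈ I
    · simp only [List.map_cons, h, decide_true, MarkedWord.extracted_cons_true, ih hL.2,
        List.filter_cons, not_true, and_false, decide_false, if_true, hnil,
        Bool.false_eq_true, if_false]
      simp
    · simp only [List.map_cons, h, decide_false, MarkedWord.extracted_cons_false, ih hL.2,
        List.filter_cons, Bool.false_eq_true, if_false, List.map_map, not_false_eq_true, and_true]
      apply List.map_congr_left
      intro j hj
      simp [hi j (List.mem_of_mem_filter hj)]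

theorem ofFn_orderEmbOfFin {n k : ℕ} (I : Finset (Fin n)) (hI : I.card = k) :
    List.ofFn (I.orderEmbOfFin hI) = (List.finRange n).filter fun i => i ∈ I := by
  have hs : ((List.finRange n).filter fun i => i ∈ I).Pairwise (· < ·) :=
    (List.pairwise_lt_finRange n).filter _
  have hs' : (List.ofFn (I.orderEmbOfFin hI)).Pairwise (· < ·) := by
    rw [List.pairwise_ofFn]
    intro i j hij
    exact (I.orderEmbOfFin hI).strictMono hij
  refine List.Perm.eq_of_pairwise (fun a b _ _ h h' => absurd h h'.asymm) hs' hs ?_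
  rw [List.perm_ext_iff_of_nodup hs'.nodup hs.nodup]
  intro a
  have := I.range_orderEmbOfFin hI
  simp only [List.mem_ofFn, List.mem_filter, List.mem_finRange, true_and, decide_eq_true_eq]
  rw [← Finset.mem_coe, ← this, Set.mem_range]

theorem ofFn_factorization (W : PositiveWord) (I : Finset (Fin W.length)) {k : ℕ}
    (hI : I.card = k) : List.ofFn (W.factorization I hI) = (W.mark I).extracted := by
  rw [mark, extracted_map_of_sorted W I _ (List.pairwise_lt_finRange _), ← ofFn_orderEmbOfFin I hI,
    List.map_ofFn]
  rfl

theorem isMinimal_of_mark {W : PositiveWord} {I : Finset (Fin W.length)}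
    (h : (W.mark I).IsMinimal) : W.IsMinimal I := by
  rintro ⟨i, j, hij, hi, hj, he⟩
  have hl : (W.mark I).length = W.length := by simp [mark]
  refine h ((W.mark I).take i) (W.get i) ((W.mark I).drop (i + 2)) ?_
  conv_lhs => rw [← List.take_append_drop i (W.mark I)]
  rw [List.drop_eq_getElem_cons (by omega), List.drop_eq_getElem_cons (by omega)]
  have e : (⟨i + 1, by omega⟩ : Fin W.length) = j := Fin.ext hij.symm
  simp only [mark, List.getElem_map, List.getElem_finRange, Fin.cast_mk, Fin.eta, e, hi, hj, he,
    decide_true, decide_false]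

end PositiveWord

end ThreeBraid

namespace ThreeBraid

/-! ### Identities in the braid group -/

theorem braid_relation : σ 0 * σ 1 * σ 0 = σ 1 * σ 0 * σ 1 := by
  have h : (PresentedGroup.mk (braidRelators 3)
      (FreeGroup.of (0 : Fin 2) * FreeGroup.of 1 * FreeGroup.of 0 *
        (FreeGroup.of (1 : Fin 2) * FreeGroup.of 0 * FreeGroup.of 1)⁻¹)) = 1 :=
    PresentedGroup.one_of_mem (Or.inl ⟨0, 1, rfl, rfl⟩)
  rw [map_mul, map_inv, mul_inv_eq_one, map_mul, map_mul, map_mul, map_mul] at h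
  exact h

theorem Δ_eq : Δ = σ 1 * σ 0 * σ 1 := braid_relation

theorem Δ_mul_σ (x : Fin 2) : Δ * σ x = σ (1 - x) * Δ := by
  fin_cases x
  · change Δ * σ 0 = σ 1 * Δ
    nth_rw 1 [Δ_eq]; simp [Δ, mul_assoc]
  · change Δ * σ 1 = σ 0 * Δ
    nth_rw 2 [Δ_eq]; simp [Δ, mul_assoc]

/-- The homomorphism out of `B₃` given by the images of the generators. -/
def lift {G : Type*} [Group G] (f : Fin 2 → G) (h : f 0 * f 1 * f 0 = f 1 * f 0 * f 1) :
    BraidGroup 3 →* G :=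
  PresentedGroup.toGroup (f := f) (by
    rintro r (⟨i, j, hij, rfl⟩ | ⟨i, j, hij, rfl⟩)
    · obtain rfl : i = 0 := Fin.ext (by have := i.2; have := j.2; simp at *; omega)
      obtain rfl : j = 1 := Fin.ext (by simpa using hij)
      rw [map_mul, map_inv, mul_inv_eq_one]
      simpa using h
    · have := j.2
      omega)

@[simp] theorem lift_σ {G : Type*} [Group G] (f : Fin 2 → G)
    (h : f 0 * f 1 * f 0 = f 1 * f 0 * f 1) (x : Fin 2) : lift f h (σ x) = f x :=
  PresentedGroup.toGroup.of _

theorem closure_range_σ : Subgroup.closure (Set.range σ) = ⊤ :=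
  PresentedGroup.closure_range_of _

theorem Δ_sq_mul (g : BraidGroup 3) : Δ ^ 2 * g = g * Δ ^ 2 := by
  have h : Subgroup.closure (Set.range σ) ≤ Subgroup.centralizer {Δ ^ 2} := by
    rw [Subgroup.closure_le]
    rintro _ ⟨x, rfl⟩
    rw [SetLike.mem_coe, Subgroup.mem_centralizer_singleton_iff, eq_comm, pow_two, mul_assoc, Δ_mul_σ,
      ← mul_assoc Δ, Δ_mul_σ, sub_sub_cancel, mul_assoc]
  rw [closure_range_σ] at h
  exact (Subgroup.mem_centralizer_singleton_iff.1 (h (Subgroup.mem_top g))).symm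

/-! ### The action on the integer plane and cusps -/

/-- The images of `σ₁` and `σ₂` in `SL₂(ℤ)`. -/
def slGen : Fin 2 → Matrix.SpecialLinearGroup (Fin 2) ℤ :=
  ![⟨!![1, 1; 0, 1], by simp⟩, ⟨!![1, 0; -1, 1], by simp⟩]

/-- The representation `B₃ → SL₂(ℤ)`. -/
def toSL : BraidGroup 3 →* Matrix.SpecialLinearGroup (Fin 2) ℤ :=
  lift slGen (Subtype.ext (by decide))

theorem coe_toSL_σ_zero : (toSL (σ 0) : Matrix (Fin 2) (Fin 2) ℤ) = !![1, 1; 0, 1] :=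
  congrArg Subtype.val (lift_σ slGen _ 0)

theorem coe_toSL_σ_one : (toSL (σ 1) : Matrix (Fin 2) (Fin 2) ℤ) = !![1, 0; -1, 1] :=
  congrArg Subtype.val (lift_σ slGen _ 1)

theorem coe_toSL_Δ : (toSL Δ : Matrix (Fin 2) (Fin 2) ℤ) = !![0, 1; -1, 0] := by
  simp [Δ, coe_toSL_σ_zero, coe_toSL_σ_one]

theorem coe_toSL_σ_zero_zpow (n : ℤ) :
    (toSL (σ 0 ^ n) : Matrix (Fin 2) (Fin 2) ℤ) = !![1, n; 0, 1] := by
  rw [map_zpow]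
  have h : toSL (σ 0) = ModularGroup.T := by
    ext i j
    rw [coe_toSL_σ_zero, ModularGroup.coe_T]
  rw [h, ModularGroup.coe_T_zpow]

theorem Δ_mul_σ_zero_inv_mul_Δ : Δ * (σ 0)⁻¹ * Δ = σ 0 * Δ * σ 0 := by
  have h : Δ * (σ 0)⁻¹ = σ 0 * σ 1 := by simp [Δ]
  have h' : σ 1 * Δ = Δ * σ 0 := (Δ_mul_σ 0).symm
  rw [h, mul_assoc, h', mul_assoc]

theorem Δ_mul_σ_zero_mul_Δ : Δ * σ 0 * Δ = Δ ^ 2 * ((σ 0)⁻¹ * Δ * (σ 0)⁻¹) := by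
  have h : Δ * σ 0 = σ 1 * Δ := Δ_mul_σ 0
  have h' : σ 1 = (σ 0)⁻¹ * Δ * (σ 0)⁻¹ := by simp [Δ, mul_assoc]
  rw [h, mul_assoc, ← pow_two, ← Δ_sq_mul, ← h']

/-- The elements `Δ σ₁^{n₁} Δ σ₁^{n₂} ⋯ Δ h` with `|nᵢ| ≥ 2` and `h` commuting with `σ₁`.  They
move the cusp `∞` into the open interval `(-1, 1)`. -/
inductive IsReduced : BraidGroup 3 → Prop
  | base (h : BraidGroup 3) : Commute h (σ 0) → IsReduced (Δ * h)
  | step (n : ℤ) (c : BraidGroup 3) : 2 ≤ |n| → IsReduced c → IsReduced (Δ * (σ 0 ^ n * c))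

theorem IsReduced.Δ_sq_mul {c : BraidGroup 3} (hc : IsReduced c) : IsReduced (Δ ^ 2 * c) := by
  induction hc with
  | base h hh =>
    rw [← mul_assoc, ThreeBraid.Δ_sq_mul, mul_assoc]
    exact .base _ (Commute.mul_left (ThreeBraid.Δ_sq_mul _) hh)
  | step n c hn _ ih =>
    rw [← mul_assoc, ThreeBraid.Δ_sq_mul, mul_assoc, ← mul_assoc (Δ ^ 2),
      ThreeBraid.Δ_sq_mul (σ 0 ^ n), mul_assoc (σ 0 ^ n)]
    exact .step n _ hn ih

theorem IsReduced.Δ_sq_inv_mul {c : BraidGroup 3} (hc : IsReduced c) :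
    IsReduced ((Δ ^ 2)⁻¹ * c) := by
  have hcomm : ∀ g, Commute (Δ ^ 2)⁻¹ g := fun g =>
    Commute.inv_left (ThreeBraid.Δ_sq_mul g : Commute (Δ ^ 2) g)
  induction hc with
  | base h hh =>
    rw [← mul_assoc, (hcomm Δ).eq, mul_assoc]
    exact .base _ ((hcomm _).mul_left hh)
  | step n c hn _ ih =>
    rw [← mul_assoc, (hcomm Δ).eq, mul_assoc, ← mul_assoc _ (σ 0 ^ n), (hcomm (σ 0 ^ n)).eq,
      mul_assoc (σ 0 ^ n)]
    exact .step n _ hn ih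

/-- `g` commutes with `σ₁`, or has the form `σ₁ⁿ c` with `c` reduced. -/
def HasReducedForm (g : BraidGroup 3) : Prop :=
  Commute g (σ 0) ∨ ∃ (n : ℤ) (c : BraidGroup 3), IsReduced c ∧ g = σ 0 ^ n * c

theorem HasReducedForm.σ_zero_zpow_mul {g : BraidGroup 3} (hg : HasReducedForm g) (m : ℤ) :
    HasReducedForm (σ 0 ^ m * g) := by
  rcases hg with hg | ⟨n, c, hc, rfl⟩
  · exact Or.inl (((Commute.refl (σ 0)).zpow_left m).mul_left hg)
  · exact Or.inr ⟨m + n, c, hc, by rw [zpow_add, mul_assoc]⟩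

theorem HasReducedForm.Δ_sq_mul {g : BraidGroup 3} (hg : HasReducedForm g) :
    HasReducedForm (Δ ^ 2 * g) := by
  rcases hg with hg | ⟨n, c, hc, rfl⟩
  · exact Or.inl (Commute.mul_left (ThreeBraid.Δ_sq_mul _) hg)
  · exact Or.inr ⟨n, _, hc.Δ_sq_mul, by rw [← mul_assoc, ThreeBraid.Δ_sq_mul, mul_assoc]⟩

theorem HasReducedForm.Δ_sq_inv_mul {g : BraidGroup 3} (hg : HasReducedForm g) :
    HasReducedForm ((Δ ^ 2)⁻¹ * g) := by
  have hcomm : ∀ g, Commute (Δ ^ 2)⁻¹ g := fun g =>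
    Commute.inv_left (ThreeBraid.Δ_sq_mul g : Commute (Δ ^ 2) g)
  rcases hg with hg | ⟨n, c, hc, rfl⟩
  · exact Or.inl ((hcomm _).mul_left hg)
  · exact Or.inr ⟨n, _, hc.Δ_sq_inv_mul, by rw [← mul_assoc, (hcomm _).eq, mul_assoc]⟩

/-- An exponent `±1` between two factors `Δ` is removed by the braid relation; this may create
a new exponent `±1` further to the right. -/
theorem IsReduced.hasReducedForm_Δ_mul {c : BraidGroup 3} (hc : IsReduced c) :
    HasReducedForm (Δ * ((σ 0)⁻¹ * c)) ∧ HasReducedForm (Δ * (σ 0 * c)) := by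
  have h1 : ∀ g, Δ * ((σ 0)⁻¹ * (Δ * g)) = σ 0 ^ (1 : ℤ) * (Δ * (σ 0 * g)) := fun g => by
    simpa [mul_assoc] using congrArg (· * g) Δ_mul_σ_zero_inv_mul_Δ
  have h2 : ∀ g, Δ * (σ 0 * (Δ * g)) =
      Δ ^ 2 * (σ 0 ^ (-1 : ℤ) * (Δ * ((σ 0)⁻¹ * g))) := fun g => by
    simpa [mul_assoc] using congrArg (· * g) Δ_mul_σ_zero_mul_Δ
  induction hc with
  | base h hh =>
    rw [h1, h2]
    exact ⟨Or.inr ⟨1, _, .base _ ((Commute.refl _).mul_left hh), rfl⟩,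
      HasReducedForm.Δ_sq_mul (Or.inr ⟨-1, _,
        .base _ ((Commute.refl (σ 0)).inv_left.mul_left hh), rfl⟩)⟩
  | step n c hn hc ih =>
    rw [h1, h2]
    have e1 : σ 0 * (σ 0 ^ n * c) = σ 0 ^ (n + 1) * c := by
      rw [← mul_assoc, add_comm, zpow_add, zpow_one]
    have e2 : (σ 0)⁻¹ * (σ 0 ^ n * c) = σ 0 ^ (n - 1) * c := by
      rw [← mul_assoc, sub_eq_neg_add, zpow_add, zpow_neg_one]
    rw [e1, e2]
    have hn' : n ≤ -2 ∨ 2 ≤ n := by rcases le_abs.1 hn with h | h <;> omega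
    constructor
    · apply HasReducedForm.σ_zero_zpow_mul
      rcases eq_or_ne n (-2) with rfl | h
      · simpa using ih.1
      · exact Or.inr ⟨0, _, .step (n + 1) c (le_abs.2 (by omega)) hc, by simp⟩
    · apply HasReducedForm.Δ_sq_mul
      apply HasReducedForm.σ_zero_zpow_mul
      rcases eq_or_ne n 2 with rfl | h
      · simpa using ih.2
      · exact Or.inr ⟨0, _, .step (n - 1) c (le_abs.2 (by omega)) hc, by simp⟩

theorem HasReducedForm.Δ_mul {g : BraidGroup 3} (hg : HasReducedForm g) :
    HasReducedForm (Δ * g) := by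
  rcases hg with hg | ⟨n, c, hc, rfl⟩
  · exact Or.inr ⟨0, _, .base _ hg, by simp⟩
  · by_cases hn : 2 ≤ |n|
    · exact Or.inr ⟨0, _, .step n c hn hc, by simp⟩
    · have : n = -1 ∨ n = 0 ∨ n = 1 := by
        rw [not_le, abs_lt] at hn
        omega
      rcases this with rfl | rfl | rfl
      · simpa using hc.hasReducedForm_Δ_mul.1
      · rw [zpow_zero, one_mul]
        cases hc with
        | base h hh =>
          rw [← mul_assoc, ← pow_two]
          exact HasReducedForm.Δ_sq_mul (Or.inl hh)
        | step n c hn hc =>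
          rw [← mul_assoc, ← pow_two]
          exact HasReducedForm.Δ_sq_mul (Or.inr ⟨n, c, hc, rfl⟩)
      · simpa using hc.hasReducedForm_Δ_mul.2

theorem hasReducedForm (g : BraidGroup 3) : HasReducedForm g := by
  have hΔ : ∀ g, HasReducedForm g → HasReducedForm (Δ⁻¹ * g) := fun g hg => by
    have h : Δ⁻¹ * g = (Δ ^ 2)⁻¹ * (Δ * g) := by simp [pow_two, mul_assoc]
    rw [h]
    exact hg.Δ_mul.Δ_sq_inv_mul
  have h1 : σ 1 = Δ * σ 0 * Δ⁻¹ := by rw [Δ_mul_σ 0]; simp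
  have hg : g ∈ Subgroup.closure (Set.range σ) := closure_range_σ ▸ Subgroup.mem_top g
  induction hg using Subgroup.closure_induction_left with
  | one => exact Or.inl (Commute.one_left _)
  | mul_left x hx y _ hy =>
    obtain ⟨i, rfl⟩ := hx
    fin_cases i
    · simpa using hy.σ_zero_zpow_mul 1
    · change HasReducedForm (σ 1 * y)
      rw [h1]
      simpa [mul_assoc] using ((hΔ y hy).σ_zero_zpow_mul 1).Δ_mul
  | inv_mul_cancel x hx y _ hy =>
    obtain ⟨i, rfl⟩ := hx
    fin_cases i
    · simpa using hy.σ_zero_zpow_mul (-1)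
    · change HasReducedForm ((σ 1)⁻¹ * y)
      rw [h1]
      simpa [mul_assoc] using ((hΔ y hy).σ_zero_zpow_mul (-1)).Δ_mul

theorem toSL_lower_left_of_commute {h : BraidGroup 3} (hh : Commute h (σ 0)) :
    toSL h 1 0 = 0 := by
  have e := congrArg (fun g => (toSL g : Matrix (Fin 2) (Fin 2) ℤ) 1 1) hh.eq
  simpa [coe_toSL_σ_zero, Matrix.mul_apply, Fin.sum_univ_two] using e

theorem toSL_Δ_mul (g : BraidGroup 3) (j : Fin 2) :
    toSL (Δ * g) 0 j = toSL g 1 j ∧ toSL (Δ * g) 1 j = -toSL g 0 j := by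
  simp [map_mul, Matrix.SpecialLinearGroup.coe_mul, coe_toSL_Δ, Matrix.mul_apply, Fin.sum_univ_two]

theorem toSL_σ_zero_zpow_mul (n : ℤ) (g : BraidGroup 3) (j : Fin 2) :
    toSL (σ 0 ^ n * g) 0 j = toSL g 0 j + n * toSL g 1 j ∧
      toSL (σ 0 ^ n * g) 1 j = toSL g 1 j := by
  rw [map_mul, Matrix.SpecialLinearGroup.coe_mul, coe_toSL_σ_zero_zpow]
  simp [Matrix.mul_apply, Fin.sum_univ_two]

theorem IsReduced.abs_lt {c : BraidGroup 3} (hc : IsReduced c) :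
    |toSL c 0 0| < |toSL c 1 0| := by
  induction hc with
  | base h hh =>
    have h0 := toSL_lower_left_of_commute hh
    have hdet := (toSL h).det_coe
    rw [Matrix.det_fin_two, h0, mul_zero, sub_zero] at hdet
    rw [(toSL_Δ_mul h 0).1, (toSL_Δ_mul h 0).2, h0, abs_zero, abs_pos, neg_ne_zero]
    rintro e
    simp [e] at hdet
  | step n c hn _ ih =>
    rw [(toSL_Δ_mul _ 0).1, (toSL_Δ_mul _ 0).2, (toSL_σ_zero_zpow_mul n c 0).1,
      (toSL_σ_zero_zpow_mul n c 0).2, abs_neg]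
    have h1 : |n * toSL c 1 0| ≤ |toSL c 0 0 + n * toSL c 1 0| + |toSL c 0 0| := by
      have := abs_sub (toSL c 0 0 + n * toSL c 1 0) (toSL c 0 0)
      simpa using this
    rw [abs_mul] at h1
    nlinarith [abs_nonneg (toSL c 1 0)]

/-- The stabilizer of the cusp `∞` centralizes `σ₁`. -/
theorem commute_σ_zero_of_toSL_eq_zero {g : BraidGroup 3} (hg : toSL g 1 0 = 0) :
    Commute g (σ 0) := by
  rcases hasReducedForm g with h | ⟨n, c, hc, rfl⟩
  · exact h
  · rw [(toSL_σ_zero_zpow_mul n c 0).2] at hg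
    have := hc.abs_lt
    rw [hg, abs_zero] at this
    exact absurd this (abs_nonneg _).not_gt

/-! ### A height function on the Farey tree -/

/-- The ends of the Farey edge `{g ∞, g 0}` that are different from `∞` are at least `n`.  The ends
are the quotients of the two columns of `toSL g`; the inequality `n ≤ u / v` is multiplied by `v²`,
so that it holds automatically for the end `∞`, where `v = 0`. -/
def IsAbove (n : ℤ) (g : BraidGroup 3) : Prop :=
  ∀ j, 0 ≤ (toSL g 0 j - n * toSL g 1 j) * toSL g 1 j

theorem toSL_mul_Δ (g : BraidGroup 3) (i : Fin 2) :
    toSL (g * Δ) i 0 = -toSL g i 1 ∧ toSL (g * Δ) i 1 = toSL g i 0 := by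
  simp [map_mul, Matrix.SpecialLinearGroup.coe_mul, coe_toSL_Δ, Matrix.mul_apply, Fin.sum_univ_two]

theorem toSL_mul_σ_zero (g : BraidGroup 3) (i : Fin 2) :
    toSL (g * σ 0) i 0 = toSL g i 0 ∧ toSL (g * σ 0) i 1 = toSL g i 0 + toSL g i 1 := by
  simp [map_mul, Matrix.SpecialLinearGroup.coe_mul, coe_toSL_σ_zero, Matrix.mul_apply,
    Fin.sum_univ_two]

theorem isAbove_mul_Δ {n : ℤ} {g : BraidGroup 3} : IsAbove n (g * Δ) ↔ IsAbove n g := by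
  simp only [IsAbove, Fin.forall_fin_two, (toSL_mul_Δ g _).1, (toSL_mul_Δ g _).2]
  rw [and_comm]
  ring_nf

theorem isAbove_mul_Δ_pow {n : ℤ} {g : BraidGroup 3} (p : ℕ) :
    IsAbove n (g * Δ ^ p) ↔ IsAbove n g := by
  induction p with
  | zero => simp
  | succ p ih => rw [pow_succ, ← mul_assoc, isAbove_mul_Δ, ih]

theorem isAbove_σ_zero_mul {n : ℤ} {g : BraidGroup 3} :
    IsAbove (n + 1) (σ 0 * g) ↔ IsAbove n g := by
  have h := toSL_σ_zero_zpow_mul 1 g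
  simp only [zpow_one, one_mul] at h
  simp only [IsAbove, (h _).1, (h _).2, add_mul n, one_mul, add_sub_add_right_eq_sub]

/-- Rotating an edge about one of its ends can raise its height only if the rotation sweeps over
the cusp `∞`. -/
theorem commute_of_isAbove_mul_σ_zero {n : ℤ} {g : BraidGroup 3} (h : IsAbove n (g * σ 0))
    (h' : ¬ IsAbove n g) : Commute g (σ 0) := by
  apply commute_σ_zero_of_toSL_eq_zero
  by_contra hq
  apply h'
  have hdet := (toSL g).det_coe
  rw [Matrix.det_fin_two] at hdet
  simp only [IsAbove, Fin.forall_fin_two, (toSL_mul_σ_zero g _).1, (toSL_mul_σ_zero g _).2] at h ⊢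
  refine ⟨h.1, ?_⟩
  obtain ⟨h1, h2⟩ := h
  generalize toSL g 0 0 = p, toSL g 1 0 = q, toSL g 0 1 = r, toSL g 1 1 = s at *
  obtain ⟨u, rfl⟩ : ∃ u, p = u + n * q := ⟨p - n * q, by ring⟩
  obtain ⟨v, rfl⟩ : ∃ v, r = v + n * s := ⟨r - n * s, by ring⟩
  have hdet : u * s - v * q = 1 := by linarith
  have h1 : 0 ≤ u * q := by linarith
  have h2 : 0 ≤ (u + v) * (q + s) := by linarith
  suffices 0 ≤ v * s by linarith
  by_contra! hvs
  rcases lt_or_gt_of_ne hq with hq | hq <;> rcases mul_neg_iff.1 hvs with ⟨hv, hs⟩ | ⟨hv, hs⟩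
  · have hu : u ≤ 0 := by nlinarith
    have : u + v ≤ 0 := by nlinarith
    nlinarith
  · have hu : u ≤ 0 := by nlinarith
    nlinarith
  · have hu : 0 ≤ u := by nlinarith
    nlinarith
  · have hu : 0 ≤ u := by nlinarith
    have : 0 ≤ u + v := by nlinarith
    nlinarith

theorem conj_σ_eq_of_isAbove_mul_σ {n : ℤ} {g : BraidGroup 3} {x : Fin 2}
    (h : IsAbove n (g * σ x)) (h' : ¬ IsAbove n g) : g * σ x * g⁻¹ = σ 0 := by
  fin_cases x
  · exact mul_inv_eq_iff_eq_mul.2 (commute_of_isAbove_mul_σ_zero h h').eq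
  · change g * σ 1 * g⁻¹ = σ 0
    -- `Δ` exchanges the ends of the edge and turns `σ₂` into `σ₁`.
    have e : σ 1 * Δ = Δ * σ 0 := (Δ_mul_σ 0).symm
    have hc : Commute (g * Δ) (σ 0) := by
      refine commute_of_isAbove_mul_σ_zero (n := n) ?_ (by rwa [isAbove_mul_Δ])
      rw [mul_assoc, ← e, ← mul_assoc, isAbove_mul_Δ]
      exact h
    rw [mul_inv_eq_iff_eq_mul, ← mul_left_inj Δ, mul_assoc, e, ← mul_assoc, hc.eq, mul_assoc]

/-- The largest `n` with `IsAbove n g` is the height of the edge `{g ∞, g 0}` over the cusp `∞`. -/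
theorem exists_isAbove_and_not (g : BraidGroup 3) :
    ∃ n, IsAbove n g ∧ ¬ IsAbove (n + 1) g := by
  by_contra! hstep
  set N : ℤ := |toSL g 0 0| + |toSL g 0 1| with hN
  have hN0 : ∀ j, |toSL g 0 j| ≤ N := by
    simp [Fin.forall_fin_two, hN]
  have hlow : IsAbove (-N) g := fun j => by
    have h1 := (abs_le.1 (hN0 j))
    rcases eq_or_ne (toSL g 1 j) 0 with h | h
    · simp [h]
    · have : |toSL g 0 j| ≤ N * |toSL g 1 j| := by
        nlinarith [hN0 j, Int.one_le_abs h, abs_nonneg (toSL g 0 j)]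
      have h3 : |toSL g 0 j * toSL g 1 j| ≤ N * (toSL g 1 j * toSL g 1 j) := by
        rw [abs_mul, ← abs_mul_abs_self (toSL g 1 j), ← mul_assoc]
        exact mul_le_mul_of_nonneg_right this (abs_nonneg _)
      nlinarith [(abs_le.1 h3).1]
  have hall : ∀ m : ℕ, IsAbove (-N + m) g := fun m => by
    induction m with
    | zero => simpa using hlow
    | succ m ih => simpa [add_assoc] using hstep _ ih
  have hhigh : IsAbove (N + 1) g := by
    have := hall (2 * N + 1).toNat
    rwa [Int.toNat_of_nonneg (by have := hN0 0; have := abs_nonneg (toSL g 0 0); omega),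
      show -N + (2 * N + 1) = N + 1 by ring] at this
  have hzero : ∀ j, toSL g 1 j = 0 := fun j => by
    by_contra h
    have h1 := hhigh j
    have h2 := abs_le.1 (hN0 j)
    have h3 : 0 ≤ N := (abs_nonneg _).trans (hN0 j)
    rcases lt_or_gt_of_ne h with h | h
    · have := nonpos_of_mul_nonneg_left h1 h
      nlinarith
    · have := nonneg_of_mul_nonneg_left h1 h
      nlinarith
  have hdet := (toSL g).det_coe
  rw [Matrix.det_fin_two, hzero, hzero] at hdet
  simp at hdet

/-- If a conjugate `Y` of `σ₁` is such that `Y Δ^p` is represented by the positive word `W`, then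
`Y` is one of the elements obtained from a letter of `W` by conjugating it with the letters before
it.  Indeed, multiplication by `Y` raises the height of an edge over the cusp fixed by `Y`, so at
some letter of `W` this height must go up. -/
theorem exists_conj_prefix_eq {Y : BraidGroup 3} (hY : IsConj (σ 0) Y) {p : ℕ} {W : PositiveWord}
    (h : Y * Δ ^ p = W.toBraid) :
    ∃ U x V, W = U ++ x :: V ∧ MulAut.conj (PositiveWord.toBraid U) (σ x) = Y := by
  obtain ⟨c, rfl⟩ := isConj_iff.1 hY
  obtain ⟨n, hn, hn'⟩ := exists_isAbove_and_not c⁻¹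
  have hW : IsAbove (n + 1) (c⁻¹ * W.toBraid) := by
    rw [← h, ← mul_assoc, isAbove_mul_Δ_pow]
    simpa [mul_assoc, isAbove_σ_zero_mul] using hn
  clear h
  induction W using List.reverseRecOn with
  | nil => exact absurd (by simpa [PositiveWord.toBraid] using hW) hn'
  | append_singleton U x ih =>
    by_cases hU : IsAbove (n + 1) (c⁻¹ * PositiveWord.toBraid U)
    · obtain ⟨U', y, V, rfl, hy⟩ := ih hU
      exact ⟨U', y, V ++ [x], by simp, hy⟩
    · refine ⟨U, x, [], rfl, ?_⟩
      have hx := conj_σ_eq_of_isAbove_mul_σ (x := x)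
        (by simpa [PositiveWord.toBraid, mul_assoc] using hW) hU
      rw [← hx]
      simp [mul_assoc]

end ThreeBraid

namespace ThreeBraid

open PositiveWord

/-! ### Braid relations on positive words -/

/-- The word `x (1 - x) x`; for both letters `x` it represents `Δ`. -/
def ΔWord (x : Fin 2) : PositiveWord := [x, 1 - x, x]

theorem toBraid_ΔWord (x : Fin 2) : toBraid (ΔWord x) = Δ := by
  fin_cases x
  · simp [ΔWord, Δ, mul_assoc]
  · simp [ΔWord, Δ_eq, mul_assoc]

/-- One application of the braid relation inside a positive word. -/
inductive BraidStep : PositiveWord → PositiveWord → Prop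
  | mk (U : PositiveWord) (x : Fin 2) (V : PositiveWord) :
      BraidStep (U ++ ΔWord x ++ V) (U ++ ΔWord (1 - x) ++ V)

/-- Equality of positive words in the monoid with the presentation of `B₃`. -/
def BraidEquiv : PositiveWord → PositiveWord → Prop := Relation.EqvGen BraidStep

namespace BraidEquiv

theorem refl (U : PositiveWord) : BraidEquiv U U := Relation.EqvGen.refl U

theorem symm {U V : PositiveWord} (h : BraidEquiv U V) : BraidEquiv V U :=
  Relation.EqvGen.symm _ _ h

theorem trans {U V W : PositiveWord} (h : BraidEquiv U V) (h' : BraidEquiv V W) :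
    BraidEquiv U W := Relation.EqvGen.trans _ _ _ h h'

theorem context (A B : PositiveWord) {U V : PositiveWord} (h : BraidEquiv U V) :
    BraidEquiv (A ++ U ++ B) (A ++ V ++ B) := by
  induction h with
  | rel _ _ h =>
    obtain ⟨U, x, V⟩ := h
    refine Relation.EqvGen.rel _ _ ?_
    simpa using BraidStep.mk (A ++ U) x (V ++ B)
  | refl => exact refl _
  | symm _ _ _ ih => exact ih.symm
  | trans _ _ _ _ _ ih ih' => exact ih.trans ih'

theorem append_left (A : PositiveWord) {U V : PositiveWord} (h : BraidEquiv U V) :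
    BraidEquiv (A ++ U) (A ++ V) := by simpa using h.context A []

theorem append_right (B : PositiveWord) {U V : PositiveWord} (h : BraidEquiv U V) :
    BraidEquiv (U ++ B) (V ++ B) := by simpa using h.context [] B

theorem ΔWord_comm (x y : Fin 2) : BraidEquiv (ΔWord x) (ΔWord y) := by
  have h : ∀ z, BraidEquiv (ΔWord z) (ΔWord (1 - z)) := fun z => by
    refine Relation.EqvGen.rel _ _ ?_
    simpa using BraidStep.mk [] z []
  by_cases hxy : y = x
  · exact hxy ▸ refl _
  · obtain rfl : y = 1 - x := by omega
    exact h x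

end BraidEquiv

/-- A positive word for `Δ²ⁿ`. -/
def ΔSqWord : ℕ → PositiveWord
  | 0 => []
  | n + 1 => ΔSqWord n ++ (ΔWord 0 ++ ΔWord 0)

theorem toBraid_ΔSqWord (n : ℕ) : toBraid (ΔSqWord n) = (Δ ^ 2) ^ n := by
  induction n with
  | zero => rfl
  | succ n ih => rw [ΔSqWord, toBraid_append, toBraid_append, toBraid_ΔWord, ih, ← pow_two, ← pow_succ]

theorem ΔSqWord_add (m n : ℕ) : ΔSqWord (m + n) = ΔSqWord m ++ ΔSqWord n := by
  induction n with
  | zero => simp [ΔSqWord]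
  | succ n ih => rw [← add_assoc, ΔSqWord, ih, ΔSqWord, List.append_assoc]

/-- The Garside element passes a letter and changes it into the other one. -/
theorem ΔWord_append_letter (x y z : Fin 2) :
    BraidEquiv (ΔWord y ++ [x]) ([1 - x] ++ ΔWord z) := by
  have h1 := (BraidEquiv.ΔWord_comm y (1 - x)).append_right [x]
  have h2 := (BraidEquiv.ΔWord_comm x z).append_left [1 - x]
  refine h1.trans (BraidEquiv.trans ?_ h2)
  simpa [ΔWord] using BraidEquiv.refl _

theorem ΔSqWord_one_append (U : PositiveWord) : BraidEquiv (ΔSqWord 1 ++ U) (U ++ ΔSqWord 1) := by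
  induction U with
  | nil => simpa using BraidEquiv.refl _
  | cons x U ih =>
    have h1 := ((ΔWord_append_letter x 0 0).append_left (ΔWord 0)).append_right U
    have h2 := (ΔWord_append_letter (1 - x) 0 0).append_right (ΔWord 0 ++ U)
    rw [sub_sub_cancel] at h2
    have h3 := ih.append_left [x]
    simp only [ΔSqWord, List.nil_append, List.append_assoc,
      List.cons_append] at h1 h2 h3 ⊢
    exact h1.trans (h2.trans h3)

theorem ΔSqWord_append (n : ℕ) (U : PositiveWord) :
    BraidEquiv (ΔSqWord n ++ U) (U ++ ΔSqWord n) := by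
  induction n with
  | zero => simpa [ΔSqWord] using BraidEquiv.refl U
  | succ n ih =>
    have h1 := (ΔSqWord_one_append U).append_left (ΔSqWord n)
    have h2 := ih.append_right (ΔSqWord 1)
    rw [← List.append_assoc] at h1
    simp only [ΔSqWord_add, List.append_assoc] at h1 h2 ⊢
    exact h1.trans h2

/-- A word `x*` with `x x* = x* x = Δ²`. -/
def letterCompl (x : Fin 2) : PositiveWord := [1 - x, x] ++ ΔWord x

theorem letter_append_letterCompl (x : Fin 2) : BraidEquiv ([x] ++ letterCompl x) (ΔSqWord 1) := by
  have h := ((BraidEquiv.ΔWord_comm x 0).append_right (ΔWord x)).trans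
    ((BraidEquiv.ΔWord_comm x 0).append_left (ΔWord 0))
  simpa [letterCompl, ΔWord, ΔSqWord] using h

theorem letterCompl_append_letter (x : Fin 2) : BraidEquiv (letterCompl x ++ [x]) (ΔSqWord 1) := by
  have h := (ΔWord_append_letter x x (1 - x)).append_left [1 - x, x]
  have h' := ((BraidEquiv.ΔWord_comm (1 - x) 0).append_right (ΔWord (1 - x))).trans
    ((BraidEquiv.ΔWord_comm (1 - x) 0).append_left (ΔWord 0))
  simp only [letterCompl, ΔWord, ΔSqWord, sub_sub_cancel, List.nil_append, List.cons_append] at h h' ⊢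
  exact h.trans h'

/-- `(U, i)` stands for `U Δ^{-2i}`; two such fractions are equal if they become equal as words
after multiplication with a common power of `Δ²`. -/
def fractionSetoid : Setoid (PositiveWord × ℕ) where
  r a b := ∃ N, BraidEquiv (a.1 ++ ΔSqWord (b.2 + N)) (b.1 ++ ΔSqWord (a.2 + N))
  iseqv :=
    { refl := fun a => ⟨0, BraidEquiv.refl _⟩
      symm := fun ⟨N, h⟩ => ⟨N, h.symm⟩
      trans := by
        rintro ⟨U, i⟩ ⟨V, j⟩ ⟨W, k⟩ ⟨N, h⟩ ⟨M, h'⟩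
        refine ⟨j + N + M, ?_⟩
        have h1 := h.append_right (ΔSqWord (k + M))
        have h2 := h'.append_right (ΔSqWord (i + N))
        simp only [List.append_assoc, ← ΔSqWord_add] at h1 h2 ⊢
        have e1 : j + N + (k + M) = k + (j + N + M) := by ring
        have e2 : i + N + (k + M) = k + M + (i + N) := by ring
        have e3 : j + M + (i + N) = i + (j + N + M) := by ring
        rw [e1, e2] at h1
        rw [e3] at h2
        exact h1.trans h2 }

/-- Formal fractions `U Δ^{-2i}` of positive words. -/
abbrev Fraction : Type := Quotient fractionSetoid

namespace Fraction

/-- Left multiplication of a fraction by a word, with the exponent of `Δ⁻²` raised by `d`. -/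
def act (A : PositiveWord) (d : ℕ) : Fraction → Fraction :=
  Quotient.map (fun a => (A ++ a.1, a.2 + d)) (by
    rintro ⟨U, i⟩ ⟨V, j⟩ ⟨N, h⟩
    refine ⟨N, ?_⟩
    have h1 := (h.append_left A).append_right (ΔSqWord d)
    simp only [List.append_assoc, ← ΔSqWord_add] at h1 ⊢
    rwa [show j + d + N = j + N + d by ring, show i + d + N = i + N + d by ring])

theorem act_act (A B : PositiveWord) (d e : ℕ) (q : Fraction) :
    act A d (act B e q) = act (A ++ B) (e + d) q := by
  induction q using Quotient.inductionOn with
  | _ a => simp [act, add_assoc]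

theorem act_congr {A B : PositiveWord} (h : BraidEquiv A B) (d : ℕ) : act A d = act B d := by
  funext q
  induction q using Quotient.inductionOn with
  | _ a =>
    refine Quotient.sound ⟨0, ?_⟩
    exact (h.append_right _).append_right _

theorem act_ΔSqWord (q : Fraction) : act (ΔSqWord 1) 1 q = q := by
  induction q using Quotient.inductionOn with
  | _ a =>
    refine Quotient.sound ⟨0, ?_⟩
    have h := (ΔSqWord_append 1 a.1).append_right (ΔSqWord a.2)
    rw [List.append_assoc a.1, ← ΔSqWord_add, add_comm 1] at h
    exact h

/-- The bijection of the set of fractions given by a letter. -/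
def letterPerm (x : Fin 2) : Equiv.Perm Fraction where
  toFun := act [x] 0
  invFun := act (letterCompl x) 1
  left_inv q := by
    rw [act_act, act_congr (letterCompl_append_letter x)]
    exact act_ΔSqWord q
  right_inv q := by
    rw [act_act, act_congr (letter_append_letterCompl x)]
    exact act_ΔSqWord q

/-- The action of `B₃` on the fractions. -/
def perm : BraidGroup 3 →* Equiv.Perm Fraction :=
  lift letterPerm (by
    ext q : 1
    simp only [Equiv.Perm.mul_apply, letterPerm, Equiv.coe_fn_mk, act_act]
    exact congrFun (act_congr (BraidEquiv.ΔWord_comm 0 1) 0) q)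

theorem perm_toBraid (U : PositiveWord) (q : Fraction) : perm (toBraid U) q = act U 0 q := by
  induction U with
  | nil =>
    induction q using Quotient.inductionOn with
    | _ a => simp [act]
  | cons x U ih =>
    rw [toBraid_cons, map_mul, Equiv.Perm.mul_apply, ih]
    simp [perm, letterPerm, act_act]

end Fraction

/-- Positive words that are equal in the braid group become equal modulo the braid relation
between words after multiplication with a power of `Δ²`. -/
theorem exists_braidEquiv_of_toBraid_eq {U V : PositiveWord} (h : toBraid U = toBraid V) :
    ∃ N, BraidEquiv (U ++ ΔSqWord N) (V ++ ΔSqWord N) := by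
  have e := Fraction.perm_toBraid U (Quotient.mk _ ([], 0))
  rw [h, Fraction.perm_toBraid] at e
  obtain ⟨N, hN⟩ := Quotient.exact e.symm
  exact ⟨N, by simpa using hN⟩

theorem σ_mul_toBraid_letterCompl (x : Fin 2) : σ x * toBraid (letterCompl x) = Δ ^ 2 := by
  have h : toBraid ([x] ++ letterCompl x) = toBraid (ΔWord x ++ ΔWord x) := rfl
  rw [toBraid_append, toBraid_append, toBraid_ΔWord, ← pow_two] at h
  simpa using h

theorem exists_mul_Δ_sq_pow_eq (g : BraidGroup 3) :
    ∃ (U : PositiveWord) (n : ℕ), g * (Δ ^ 2) ^ n = toBraid U := by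
  have hg : g ∈ Subgroup.closure (Set.range σ) := closure_range_σ ▸ Subgroup.mem_top g
  induction hg using Subgroup.closure_induction_left with
  | one => exact ⟨[], 0, by simp⟩
  | mul_left x hx y _ hy =>
    obtain ⟨i, rfl⟩ := hx
    obtain ⟨U, n, h⟩ := hy
    exact ⟨i :: U, n, by rw [toBraid_cons, ← h, mul_assoc]⟩
  | inv_mul_cancel x hx y _ hy =>
    obtain ⟨i, rfl⟩ := hx
    obtain ⟨U, n, h⟩ := hy
    refine ⟨letterCompl i ++ U, n + 1, ?_⟩
    rw [toBraid_append, ← h, inv_mul_eq_iff_eq_mul.2 (σ_mul_toBraid_letterCompl i).symm |>.symm]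
    rw [pow_succ', ← mul_assoc, mul_assoc _ y, ← Δ_sq_mul]
    simp only [mul_assoc]

end ThreeBraid

namespace ThreeBraid

open PositiveWord

/-! ### Factorizations represented by a word -/

namespace BraidEquiv

theorem toBraid_eq {U V : PositiveWord} (h : BraidEquiv U V) : toBraid U = toBraid V := by
  induction h with
  | rel _ _ h => obtain ⟨U, x, V⟩ := h; simp only [toBraid_append, toBraid_ΔWord]
  | refl => rfl
  | symm _ _ _ ih => exact ih.symm
  | trans _ _ _ _ _ ih ih' => exact ih.trans ih'

end BraidEquiv

namespace MarkedWord

/-- A word without marks. -/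
def unmarked (W : PositiveWord) : MarkedWord := W.map fun x => (x, false)

@[simp] theorem letters_unmarked (W : PositiveWord) : (unmarked W).letters = W := by
  simp [unmarked, letters, Function.comp_def]

theorem snd_eq_false_of_mem_unmarked {W : PositiveWord} : ∀ c ∈ unmarked W, c.2 = false := by
  simp [unmarked]

@[simp] theorem extracted_unmarked (W : PositiveWord) : (unmarked W).extracted = [] :=
  extracted_eq_nil snd_eq_false_of_mem_unmarked

@[simp] theorem kept_unmarked (W : PositiveWord) : (unmarked W).kept = W := by
  rw [kept_eq_letters snd_eq_false_of_mem_unmarked, letters_unmarked]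

theorem length_extracted_add_length_kept (w : MarkedWord) :
    w.extracted.length + w.kept.length = w.length := by
  induction w with
  | nil => rfl
  | cons c w ih => obtain ⟨x, _ | _⟩ := c <;> simp <;> omega

theorem all_unmarked_or_exists_marked (w : MarkedWord) :
    (∀ c ∈ w, c.2 = false) ∨ ∃ u x v, w = u ++ (x, true) :: v := by
  by_cases h : ∀ c ∈ w, c.2 = false
  · exact Or.inl h
  · push Not at h
    obtain ⟨⟨x, b⟩, hc, hb⟩ := h
    obtain rfl : b = true := by simpa using hb
    obtain ⟨u, v, rfl⟩ := List.append_of_mem hc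
    exact Or.inr ⟨u, x, v, rfl⟩

end MarkedWord

open MarkedWord

/-- Up to Hurwitz equivalence, `m` is the tuple `W_I` for some set `I` of positions of `W`. -/
def Represents (W : PositiveWord) (m : List (BraidGroup 3)) : Prop :=
  ∃ w : MarkedWord, w.letters = W ∧ HurwitzEquiv m w.extracted

/-- Up to Hurwitz equivalence, `m` begins with `U x U⁻¹`, where `x` is a letter of `W` and `U` is
formed by all letters before it. -/
def Sweeps (W : PositiveWord) (m : List (BraidGroup 3)) : Prop :=
  ∃ U x V m', W = U ++ x :: V ∧ HurwitzEquiv m (MulAut.conj (toBraid U) (σ x) :: m')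

/-- Every factorization with `k` factors of a braid `W Δ^{-p}` is represented by `W`. -/
def RepresentsAll (k : ℕ) : Prop :=
  ∀ m : List (BraidGroup 3), m.length = k → (∀ X ∈ m, IsConj (σ 0) X) →
    ∀ (W : PositiveWord) (p : ℕ), m.prod * Δ ^ p = toBraid W → Represents W m

theorem sweeps_of_marked {m : List (BraidGroup 3)} {u v : MarkedWord} {x : Fin 2}
    (h : HurwitzEquiv m (extracted (u ++ (x, true) :: v))) {U V : PositiveWord}
    (hU : toBraid (letters u) = toBraid U) : Sweeps (U ++ x :: V) m :=
  ⟨U, x, V, _, rfl, hU ▸ h.trans (extracted_move_front u x v)⟩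

/-- Deleting the letter `x` of `W` and splitting off `U x U⁻¹` reduces the number of factors. -/
theorem Sweeps.represents {k : ℕ} (ih : RepresentsAll k) {m : List (BraidGroup 3)}
    (hm : m.length = k + 1) (hc : ∀ X ∈ m, IsConj (σ 0) X) {W : PositiveWord} {p : ℕ}
    (hW : m.prod * Δ ^ p = toBraid W) (h : Sweeps W m) : Represents W m := by
  obtain ⟨U, x, V, m', rfl, he⟩ := h
  have hprod : m'.prod * Δ ^ p = toBraid (U ++ V) := by
    rw [he.prod_eq, List.prod_cons, toBraid_append, toBraid_cons] at hW
    rw [toBraid_append, ← inv_mul_eq_iff_eq_mul]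
    simpa [mul_assoc] using hW
  have hlen : m'.length = k := by
    have := he.length_eq
    simp only [List.length_cons] at this
    omega
  obtain ⟨w, hw, hm'⟩ := ih m' hlen
    (fun X hX => he.forall_isConj.1 hc X (List.mem_cons_of_mem _ hX)) (U ++ V) p hprod
  obtain ⟨u, v, rfl, rfl, rfl⟩ := List.map_eq_append_iff.1 hw
  exact ⟨u ++ (x, true) :: v, by simp [letters],
    he.trans ((hm'.cons _).trans (extracted_move_front u x v).symm)⟩

theorem letter_braid (x : Fin 2) : σ x * σ (1 - x) * σ x = σ (1 - x) * σ x * σ (1 - x) := by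
  fin_cases x
  · exact braid_relation
  · exact braid_relation.symm

/-- The block of letters representing `Δ`, with arbitrary marks. -/
def block (x : Fin 2) (a b c : Bool) : MarkedWord := [(x, a), (1 - x, b), (x, c)]

theorem letters_block (x : Fin 2) (a b c : Bool) : letters (block x a b c) = ΔWord x := rfl

/-- If two or more letters of a block `x y x` are marked, then the letter `y`, which is the first
one of the block `y x y`, can be moved to the front. -/
theorem exists_block_cons {x : Fin 2} {a b c : Bool}
    (h : 2 ≤ (extracted (block x a b c)).length) :
    ∃ m, HurwitzEquiv (extracted (block x a b c)) (σ (1 - x) :: m) := by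
  have hb := letter_braid x
  rcases a with _ | _ <;> rcases b with _ | _ <;> rcases c with _ | _ <;>
    simp [block] at h ⊢
  · exact ⟨_, (HurwitzEquiv.swap_inv _ _ _).trans (by
      simpa [mul_assoc] using HurwitzEquiv.swap_inv (σ x) (σ (1 - x)) [])⟩
  · have e : σ x * (σ (1 - x) * σ x * (σ (1 - x))⁻¹) * (σ x)⁻¹ = σ (1 - x) := by
      simp only [← mul_assoc, hb]
      group
    have h1 := HurwitzEquiv.swap (σ x) (σ (1 - x) * σ x * (σ (1 - x))⁻¹) []
    rw [e] at h1
    exact ⟨_, h1⟩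
  · exact ⟨_, HurwitzEquiv.swap_inv _ _ _⟩
  · exact ⟨_, HurwitzEquiv.swap_inv _ _ _⟩

/-- If two or more letters of a block are marked, then after conjugation by the inverse of the
unmarked part every letter can be moved to the front. -/
theorem exists_conj_block_cons {x : Fin 2} {a b c : Bool}
    (h : 2 ≤ (extracted (block x a b c)).length) (y : Fin 2) :
    ∃ m, HurwitzEquiv ((extracted (block x a b c)).map
      (MulAut.conj (toBraid (kept (block x a b c)))⁻¹)) (σ y :: m) := by
  have hb := letter_braid x
  have hy : y = x ∨ y = 1 - x := by omega
  rcases a with _ | _ <;> rcases b with _ | _ <;> rcases c with _ | _ <;>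
    simp [block] at h ⊢
  · have h1 := HurwitzEquiv.swap_inv (σ (1 - x)) (σ x) []
    rcases hy with rfl | rfl
    · exact ⟨_, by simpa [mul_assoc] using h1⟩
    · exact ⟨_, by simpa [mul_assoc] using HurwitzEquiv.refl _⟩
  · have e : (σ (1 - x))⁻¹ * σ x * σ (1 - x) = σ x * σ (1 - x) * (σ x)⁻¹ := by
      rw [eq_mul_inv_iff_mul_eq, mul_assoc, mul_assoc, inv_mul_eq_iff_eq_mul, ← mul_assoc, hb,
        mul_assoc]
    rw [e]
    have h1 := (HurwitzEquiv.swap (σ x) (σ (1 - x)) []).symm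
    rcases hy with rfl | rfl
    · exact ⟨_, by simpa [mul_assoc] using h1⟩
    · exact ⟨_, by simpa [mul_assoc] using h1.trans (HurwitzEquiv.swap_inv _ _ _)⟩
  · have h1 := HurwitzEquiv.swap (σ x) ((σ x)⁻¹ * σ (1 - x) * σ x) []
    rcases hy with rfl | rfl
    · exact ⟨_, by simpa [mul_assoc] using HurwitzEquiv.refl _⟩
    · exact ⟨_, by simpa [mul_assoc] using h1⟩
  · rcases hy with rfl | rfl
    · exact ⟨_, HurwitzEquiv.refl _⟩
    · exact ⟨_, HurwitzEquiv.swap_inv _ _ _⟩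

theorem exists_block_eq {t : MarkedWord} {x : Fin 2} (h : letters t = ΔWord x) :
    ∃ a b c, t = block x a b c := by
  simp only [letters, ΔWord, List.map_eq_cons_iff, List.map_eq_nil_iff] at h
  obtain ⟨⟨_, a⟩, _, rfl, rfl, ⟨_, b⟩, _, rfl, rfl, ⟨_, c⟩, _, rfl, rfl, rfl⟩ := h
  exact ⟨a, b, c, rfl⟩

/-! ### Invariance under the braid relation -/

/-- A factorization represented by a word is swept by the word after a braid relation. -/
theorem Represents.sweeps_braidStep {m : List (BraidGroup 3)} (hm : 2 ≤ m.length)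
    {U V : PositiveWord} {x : Fin 2} (h : Represents (U ++ ΔWord x ++ V) m) :
    Sweeps (U ++ ΔWord (1 - x) ++ V) m := by
  obtain ⟨w, hw, he⟩ := h
  obtain ⟨w', v, rfl, hw', rfl⟩ := List.map_eq_append_iff.1 hw
  obtain ⟨u, t, rfl, rfl, ht⟩ := List.map_eq_append_iff.1 hw'
  rcases all_unmarked_or_exists_marked u with hu | ⟨u₁, y, u₂, rfl⟩
  swap
  -- A marked letter before the block has the same letters before it in the new word.
  · rw [List.append_assoc, List.append_assoc, List.cons_append] at he
    have := sweeps_of_marked he (V := letters u₂ ++ ΔWord (1 - x) ++ letters v) rfl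
    simpa [letters] using this
  rcases all_unmarked_or_exists_marked v with hv | ⟨v₁, y, v₂, rfl⟩
  swap
  -- The letters before a marked letter behind the block represent the same braid in both words.
  · rw [← List.append_assoc] at he
    have := sweeps_of_marked he (U := letters u ++ ΔWord (1 - x) ++ letters v₁) (V := letters v₂)
      (by rw [letters_append, letters_append, show letters t = ΔWord x from ht]
          simp only [toBraid_append, toBraid_ΔWord])
    simpa [letters] using this
  · obtain ⟨a, b, c, rfl⟩ := exists_block_eq ht
    rw [extracted_append, extracted_append, extracted_eq_nil hu, extracted_eq_nil hv,
      kept_eq_letters hu, List.nil_append, List.map_nil, List.append_nil] at he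
    have hlen := he.length_eq
    rw [List.length_map] at hlen
    obtain ⟨m', hm'⟩ := exists_block_cons (hlen ▸ hm)
    exact ⟨letters u, 1 - x, [1 - (1 - x), 1 - x] ++ letters v, _, by simp [ΔWord, letters],
      he.trans (hm'.map (MulAut.conj (toBraid (letters u))).toMonoidHom)⟩

theorem BraidEquiv.represents_iff {k : ℕ} (ih : RepresentsAll (k + 1)) {m : List (BraidGroup 3)}
    (hm : m.length = k + 2) (hc : ∀ X ∈ m, IsConj (σ 0) X) {U V : PositiveWord}
    (h : BraidEquiv U V) {p : ℕ} (hU : m.prod * Δ ^ p = toBraid U) :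
    Represents U m ↔ Represents V m := by
  induction h with
  | rel _ _ h =>
    have hV := hU.trans (BraidEquiv.toBraid_eq (Relation.EqvGen.rel _ _ h))
    obtain ⟨U, x, V⟩ := h
    refine ⟨fun h => (h.sweeps_braidStep (by omega)).represents ih hm hc hV, fun h => ?_⟩
    have := h.sweeps_braidStep (by omega)
    rw [sub_sub_cancel] at this
    exact this.represents ih hm hc hU
  | refl => rfl
  | symm _ _ h ih =>
    exact (ih (hU.trans (BraidEquiv.toBraid_eq h).symm)).symm
  | trans _ _ _ h _ ih ih' =>
    exact (ih hU).trans (ih' (hU.trans (BraidEquiv.toBraid_eq h)))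

/-! ### Removal of a final Garside element -/

theorem exists_conj_Δ_pow_eq (q : ℕ) (x : Fin 2) :
    ∃ y, MulAut.conj (Δ ^ q) (σ y) = σ x := by
  induction q generalizing x with
  | zero => exact ⟨x, by simp⟩
  | succ q ih =>
    obtain ⟨y, hy⟩ := ih (1 - x)
    refine ⟨y, ?_⟩
    rw [pow_succ', map_mul, MulAut.mul_apply, hy, MulAut.conj_apply, Δ_mul_σ, sub_sub_cancel,
      mul_inv_cancel_right]

/-- The exponent sum of a braid. -/
def expSum : BraidGroup 3 →* Multiplicative ℤ := lift (fun _ => Multiplicative.ofAdd 1) rfl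

theorem expSum_toBraid (W : PositiveWord) :
    expSum (toBraid W) = Multiplicative.ofAdd (W.length : ℤ) := by
  induction W with
  | nil => simp
  | cons x W ih =>
    rw [toBraid_cons, map_mul, ih, expSum, lift_σ, ← ofAdd_add, List.length_cons]
    push_cast
    rw [add_comm]

theorem expSum_Δ_pow (p : ℕ) : expSum (Δ ^ p) = Multiplicative.ofAdd (3 * p : ℤ) := by
  rw [map_pow, ← toBraid_ΔWord 0, expSum_toBraid, ← ofAdd_nsmul]
  simp [ΔWord, mul_comm]

/-- A factorization of `W Δ^{-p}` represented by `W Δ` is swept by `W`.  The exponent `p` must not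
be negative: `(σ₁, σ₂, σ₁)` is represented by `Δ`, but not by the empty word. -/
theorem Represents.sweeps_of_append_Δ {m : List (BraidGroup 3)} (hm : 2 ≤ m.length)
    {W : PositiveWord} {p : ℕ} (hW : m.prod * Δ ^ p = toBraid W)
    (h : Represents (W ++ ΔWord 0) m) : Sweeps W m := by
  obtain ⟨w, hw, he⟩ := h
  obtain ⟨u, t, rfl, rfl, ht⟩ := List.map_eq_append_iff.1 hw
  rcases all_unmarked_or_exists_marked u with hu | ⟨u₁, y, u₂, rfl⟩
  swap
  · rw [List.append_assoc, List.cons_append] at he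
    simpa [letters] using sweeps_of_marked he (V := letters u₂) rfl
  obtain ⟨a, b, c, rfl⟩ := exists_block_eq ht
  have hprod := prod_extracted (u ++ block 0 a b c)
  rw [← he.prod_eq, letters_append, letters_block, kept_append, kept_eq_letters hu, toBraid_append,
    toBraid_append, toBraid_ΔWord] at hprod
  rw [extracted_append, extracted_eq_nil hu, kept_eq_letters hu, List.nil_append] at he
  have hlen := he.length_eq
  rw [List.length_map] at hlen
  rw [hlen] at hm
  change m.prod * Δ ^ p = toBraid (letters u) at hW
  change Sweeps (letters u) m
  -- The unmarked letters form a word for `Δ^(p+1)`.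
  have hkept : toBraid (letters u) * toBraid (kept (block 0 a b c)) = Δ ^ (p + 1) := by
    rw [← hW, mul_assoc] at hprod
    rw [← hW, pow_succ]
    simpa [mul_assoc] using hprod
  -- At most one letter of the block is unmarked, so the word before the block is not empty.
  obtain ⟨z, V, hz⟩ : ∃ z V, letters u = z :: V := by
    apply List.exists_cons_of_ne_nil
    intro hnil
    rw [hnil, toBraid_nil, one_mul] at hkept
    have h1 := congrArg expSum hkept
    rw [expSum_toBraid, expSum_Δ_pow] at h1
    have h2 := Multiplicative.ofAdd.injective h1
    have h3 := length_extracted_add_length_kept (block 0 a b c)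
    have h4 : (block 0 a b c).length = 3 := rfl
    push_cast at h2
    omega
  obtain ⟨y, hy⟩ := exists_conj_Δ_pow_eq (p + 1) z
  obtain ⟨m', hm'⟩ := exists_conj_block_cons hm y
  have h1 := hm'.map (MulAut.conj (Δ ^ (p + 1))).toMonoidHom
  have h2 : toBraid (letters u) = Δ ^ (p + 1) * (toBraid (kept (block 0 a b c)))⁻¹ :=
    eq_mul_inv_of_mul_eq hkept
  refine ⟨[], z, V, m'.map (MulAut.conj (Δ ^ (p + 1))), hz, ?_⟩
  rw [h2, map_mul] at he
  rw [toBraid_nil, map_one, MulAut.one_apply, ← hy]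
  refine he.trans ?_
  simpa [List.map_map, Function.comp_def] using h1

theorem Represents.of_append_ΔSqWord {k : ℕ} (ih : RepresentsAll (k + 1))
    {m : List (BraidGroup 3)} (hm : m.length = k + 2) (hc : ∀ X ∈ m, IsConj (σ 0) X)
    {W : PositiveWord} {p : ℕ} (hW : m.prod * Δ ^ p = toBraid W) (n : ℕ)
    (h : Represents (W ++ ΔSqWord n) m) : Represents W m := by
  have hΔ : ∀ {W : PositiveWord} {p : ℕ}, m.prod * Δ ^ p = toBraid W →
      Represents (W ++ ΔWord 0) m → Represents W m := fun hW h =>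
    (h.sweeps_of_append_Δ (by omega) hW).represents ih hm hc hW
  have hmul : ∀ {W : PositiveWord} {p : ℕ}, m.prod * Δ ^ p = toBraid W →
      m.prod * Δ ^ (p + 1) = toBraid (W ++ ΔWord 0) := fun hW => by
    rw [toBraid_append, ← hW, toBraid_ΔWord, pow_succ, mul_assoc]
  induction n with
  | zero => simpa [ΔSqWord] using h
  | succ n ihn =>
    apply ihn
    have h1 : m.prod * Δ ^ (p + 2 * n) = toBraid (W ++ ΔSqWord n) := by
      rw [toBraid_append, ← hW, toBraid_ΔSqWord, pow_add, pow_mul, mul_assoc]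
    exact hΔ h1 (hΔ (hmul h1) (by simpa [ΔSqWord] using h))

/-! ### Existence of representations -/

/-- Every tuple of conjugates of `σ₁` is extracted from some word: write the conjugating elements
as positive words, up to powers of the central element `Δ²`. -/
theorem exists_markedWord (m : List (BraidGroup 3)) (hc : ∀ X ∈ m, IsConj (σ 0) X) :
    ∃ (w : MarkedWord) (n : ℕ), extracted w = m ∧ toBraid (kept w) = (Δ ^ 2) ^ n := by
  induction m with
  | nil => exact ⟨[], 0, by simp⟩
  | cons X m ih =>
    obtain ⟨w, n, rfl, hw⟩ := ih fun Y hY => hc Y (List.mem_cons_of_mem _ hY)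
    obtain ⟨c, rfl⟩ := isConj_iff.1 (hc X List.mem_cons_self)
    have hcomm : ∀ (i : ℕ) g, Commute ((Δ ^ 2) ^ i) g := fun i g =>
      Commute.pow_left (Δ_sq_mul g : Commute (Δ ^ 2) g) i
    obtain ⟨U, i, hU⟩ := exists_mul_Δ_sq_pow_eq c
    obtain ⟨V, j, hV⟩ := exists_mul_Δ_sq_pow_eq (toBraid U)⁻¹
    have hUV : toBraid U * toBraid V = (Δ ^ 2) ^ j := by rw [← hV, mul_inv_cancel_left]
    refine ⟨unmarked U ++ (0, true) :: (unmarked V ++ w), j + n, ?_, ?_⟩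
    · have h1 : toBraid U * σ 0 * (toBraid U)⁻¹ = c * σ 0 * c⁻¹ := by
        rw [← hU, mul_inv_rev, mul_assoc c, (hcomm i (σ 0)).eq]
        group
      have h2 : (⇑(MulAut.conj (toBraid U)) ∘ ⇑(MulAut.conj (toBraid V))) = id := by
        funext g
        rw [Function.comp_apply, ← MulAut.mul_apply, ← map_mul, hUV, MulAut.conj_apply,
          (hcomm j g).eq, mul_inv_cancel_right, id]
      rw [extracted_append, extracted_cons_true, extracted_append]
      simp only [extracted_unmarked, kept_unmarked, List.nil_append, List.map_cons, List.map_map,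
        h2, List.map_id, MulAut.conj_apply, h1]
    · rw [kept_append, kept_cons_true, kept_append, kept_unmarked, kept_unmarked, toBraid_append,
        toBraid_append, ← mul_assoc, hUV, hw, pow_add]

theorem exists_toBraid_eq_Δ_pow (p : ℕ) : ∃ V : PositiveWord, toBraid V = Δ ^ p := by
  induction p with
  | zero => exact ⟨[], rfl⟩
  | succ p ih =>
    obtain ⟨V, hV⟩ := ih
    exact ⟨V ++ ΔWord 0, by rw [toBraid_append, hV, toBraid_ΔWord, pow_succ]⟩

/-- Every quasipositive factorization of `W Δ^{-p}` is represented by `W`. -/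
theorem representsAll (k : ℕ) : RepresentsAll k := by
  induction k with
  | zero =>
    intro m hm _ W p _
    obtain rfl := List.length_eq_zero_iff.1 hm
    exact ⟨unmarked W, by simp, by simpa using HurwitzEquiv.refl _⟩
  | succ k ih =>
    intro m hm hc W p hW
    rcases k with _ | k
    · obtain ⟨Y, rfl⟩ := List.length_eq_one_iff.1 hm
      obtain ⟨U, x, V, rfl, hY⟩ := exists_conj_prefix_eq (hc Y (by simp)) (by simpa using hW)
      exact Sweeps.represents ih hm hc hW ⟨U, x, V, [], rfl, hY ▸ HurwitzEquiv.refl _⟩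
    · obtain ⟨w, n, hwm, hwn⟩ := exists_markedWord m hc
      -- `w Δ^p` and `W Δ^(2n)` represent the same braid.
      obtain ⟨V, hV⟩ := exists_toBraid_eq_Δ_pow p
      have hw := prod_extracted w
      rw [hwm, hwn] at hw
      have hV' : m.prod * Δ ^ (2 * n + p) = toBraid (letters w ++ V) := by
        rw [toBraid_append, ← hw, hV, pow_add, pow_mul, mul_assoc]
      have heq : toBraid (letters w ++ V) = toBraid (W ++ ΔSqWord n) := by
        rw [← hV', toBraid_append, ← hW, toBraid_ΔSqWord, add_comm, pow_add, pow_mul, mul_assoc]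
      obtain ⟨N, hN⟩ := exists_braidEquiv_of_toBraid_eq heq
      have hrep : Represents (letters w ++ V ++ ΔSqWord N) m := by
        refine ⟨w ++ unmarked V ++ unmarked (ΔSqWord N), by simp, ?_⟩
        simpa [extracted_append, hwm] using HurwitzEquiv.refl m
      have hrep' := (hN.represents_iff ih hm hc (p := 2 * n + p + 2 * N) (by
        rw [toBraid_append, ← hV', toBraid_ΔSqWord, pow_add _ (2 * n + p), pow_mul _ 2 N,
          mul_assoc])).1 hrep
      rw [List.append_assoc, ← ΔSqWord_add] at hrep'
      exact hrep'.of_append_ΔSqWord ih hm hc hW _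

end ThreeBraid

/-! ### The theorem -/

/-- Every Hurwitz orbit of quasipositive factorizations `F` of `X = W Δ^{-p}` contains some `W_I`
with `I` a `W`-minimal set of positions; moreover `W ∖ I` equals `Δ^p` in `B_3`. -/
theorem theorem1 (W : ThreeBraid.PositiveWord) (p : ℕ) (X : BraidGroup 3)
    (hXW : X = W.toBraid * (ThreeBraid.Δ ^ p)⁻¹)
    (hX : ThreeBraid.IsQuasipositive X) :
    ∀ (k : ℕ) (F : Fin k → BraidGroup 3), ThreeBraid.IsQuasipositiveFactorization X F →
      ∃ (I : Finset (Fin W.length)) (hI : I.card = k),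
        W.IsMinimal I ∧
        W.factorization I hI ∈ hurwitzOrbit F ∧
        (W.remove I).toBraid = ThreeBraid.Δ ^ p := by
  intro k F hF
  have hprod : (List.ofFn F).prod * ThreeBraid.Δ ^ p = W.toBraid := by
    rw [hF.1, hXW, inv_mul_cancel_right]
  obtain ⟨w, hw, he⟩ := ThreeBraid.representsAll k (List.ofFn F) List.length_ofFn
    (by simpa [List.forall_mem_ofFn_iff] using hF.2) W p hprod
  obtain ⟨w', hw', hex, hmin⟩ := w.exists_isMinimal
  obtain ⟨I, rfl⟩ := ThreeBraid.PositiveWord.exists_mark_eq (hw'.trans hw)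
  rw [← hex] at he
  have hI : I.card = k := by
    have h := congrArg List.length (ThreeBraid.PositiveWord.ofFn_factorization W I rfl)
    rw [List.length_ofFn, ← he.length_eq, List.length_ofFn] at h
    exact h
  refine ⟨I, hI, ThreeBraid.PositiveWord.isMinimal_of_mark hmin, ?_, ?_⟩
  · rw [← ThreeBraid.PositiveWord.ofFn_factorization W I hI] at he
    exact he.mem_orbit
  · have h := ThreeBraid.MarkedWord.prod_extracted (W.mark I)
    rw [← he.prod_eq, hw', hw, ← hprod, ThreeBraid.PositiveWord.kept_mark] at h
    exact mul_left_cancel h
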